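/- Let $\Gamma$ be a group acting on a compact metric space $(X,\rho)$, and suppose that the action is Lyapunov stable: for every $\varepsilon>0$ and every $x\in X$ there is $\delta>0$ such that $\rho(x,y)<\delta$ implies $\rho(gx,gy)<\varepsilon$ for all $g\in\Gamma$. Let $C_\Gamma(X)$ be the $C^*$-algebra of continuous functions $f:X\to\mathbb C$ with $f(gx)=f(x)$ for all $g\in\Gamma$, $x\in X$. For $\varphi\in C(X)$ and $x\in X$ the function $\varphi_x(g)=\varphi(gx)$ on $\Gamma$ is almost periodic; let $M$ denote the unique invariant mean on the almost periodic functions on $\Gamma$, i.e. $M(f)$ is the unique constant that is a uniform limit of functions $(g_1,g_2)\mapsto\frac1n\sum_{j=1}^n f(g_1h_jg_2)$ with $h_1,\dots,h_n\in\Gamma$. Let $L_\Gamma(X)$ be the Hilbert $C_\Gamma(X)$-module obtained by completing $C(X)$ with respect to the $C_\Gamma(X)$-valued inner product $$\langle\varphi,\psi\rangle(x)=M(\varphi_x\overline{\psi_x}),\qquad x\in X,$$ i.e. in the norm $\|\varphi\|=\|\langle\varphi,\varphi\rangle\|^{1/2}$. Then $L_\Gamma(X)$ is $C^*$-reflexive: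 writing $E'$ for the Banach $C_\Gamma(X)$-module of all bounded $C_\Gamma(X)$-linear maps $E\to C_\Gamma(X)$, the canonical map $L_\Gamma(X)\to L_\Gamma(X)''$, $x\mapsto(f\mapsto f(x))$, is bijective. -/

import Mathlib

open scoped ComplexOrder

/-! ### Almost periodic functions on a group and their mean -/

/-- `f` is almost periodic on the (discrete) group `Γ`: its translates `h ↦ f (h * g)`, `g ∈ Γ`,
form a totally bounded set for the uniform norm (finite `ε`-nets consist of translates). -/
def IsAlmostPeriodic {Γ : Type*} [Group Γ] (f : Γ → ℂ) : Prop :=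
  ∀ ε > (0 : ℝ), ∃ t : Finset Γ, ∀ g, ∃ k ∈ t, ∀ h, ‖f (h * g) - f (h * k)‖ < ε

/-- Some finite average of two-sided translates of `f` is uniformly `ε`-close to the
constant `c`. -/
def IsApproxMean {Γ : Type*} [Group Γ] (f : Γ → ℂ) (c : ℂ) (ε : ℝ) : Prop :=
  ∃ n : ℕ, 0 < n ∧ ∃ h : Fin n → Γ, ∀ g₁ g₂, ‖(∑ j, f (g₁ * h j * g₂)) / n - c‖ < ε

/-- The constant `c` is a uniform limit of finite averages of two-sided translates of `f`. -/
def IsMeanValue {Γ : Type*} [Group Γ] (f : Γ → ℂ) (c : ℂ) : Prop :=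
  ∀ ε > (0 : ℝ), IsApproxMean f c ε

open Classical in
/-- The invariant mean `M` on almost periodic functions: `M f` is the unique constant which is a
uniform limit of averages of translates of `f`. Existence and uniqueness for
almost periodic `f` are proved below (and the value `0` elsewhere is never used). -/
noncomputable def apMean {Γ : Type*} [Group Γ] (f : Γ → ℂ) : ℂ :=
  if h : ∃ c, IsMeanValue f c then h.choose else 0

namespace IsMeanValue

variable {Γ : Type*} [Group Γ]

theorem common {f f' : Γ → ℂ} {c c' : ℂ} {ε ε' : ℝ}
    (h : IsApproxMean f c ε) (h' : IsApproxMean f' c' ε') :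
    ∃ n : ℕ, 0 < n ∧ ∃ l : Fin n → Γ,
      (∀ g₁ g₂, ‖(∑ j, f (g₁ * l j * g₂)) / n - c‖ < ε) ∧
      (∀ g₁ g₂, ‖(∑ j, f' (g₁ * l j * g₂)) / n - c'‖ < ε') := by
  obtain ⟨n, hn, a, ha⟩ := h
  obtain ⟨m, hm, b, hb⟩ := h'
  have hn' : (n : ℂ) ≠ 0 := by exact_mod_cast hn.ne'
  have hm' : (m : ℂ) ≠ 0 := by exact_mod_cast hm.ne'
  have hnR : (0 : ℝ) < n := by exact_mod_cast hn
  have hmR : (0 : ℝ) < m := by exact_mod_cast hm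
  have key : ∀ F : Γ → ℂ, (∑ j : Fin (n * m),
      F (a (finProdFinEquiv.symm j).1 * b (finProdFinEquiv.symm j).2)) =
      ∑ i, ∑ j, F (a i * b j) := by
    intro F
    rw [finProdFinEquiv.symm.sum_comp (fun p : Fin n × Fin m => F (a p.1 * b p.2)),
      Fintype.sum_prod_type]
  have avg : ∀ (k : ℕ) (u : Fin k → ℂ) (d : ℂ) (η : ℝ), 0 < k → (∀ i, ‖u i - d‖ < η) →
      ‖(∑ i, u i) / k - d‖ < η := by
    intro k u d η hk hu
    have hkR : (0 : ℝ) < k := by exact_mod_cast hk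
    have hkC : (k : ℂ) ≠ 0 := by exact_mod_cast hk.ne'
    have e : (∑ i, u i) / k - d = (∑ i, (u i - d)) / k := by
      rw [Finset.sum_sub_distrib]
      simp
      field_simp
    rw [e, norm_div, Complex.norm_natCast, div_lt_iff₀ hkR]
    have : Nonempty (Fin k) := ⟨⟨0, hk⟩⟩
    calc ‖∑ i, (u i - d)‖ ≤ ∑ i, ‖u i - d‖ := norm_sum_le _ _
      _ < ∑ _i : Fin k, η := Finset.sum_lt_sum_of_nonempty Finset.univ_nonempty
          (fun i _ => hu i)
      _ = η * k := by simp [mul_comm]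
  refine ⟨n * m, Nat.mul_pos hn hm,
    fun j => a (finProdFinEquiv.symm j).1 * b (finProdFinEquiv.symm j).2, ?_, ?_⟩
  · intro g₁ g₂
    rw [key (fun x => f (g₁ * x * g₂)), Finset.sum_comm]
    have := avg m (fun j => (∑ i, f (g₁ * (a i * b j) * g₂)) / n) c ε hm (fun j => by
      simpa [mul_assoc] using ha g₁ (b j * g₂))
    rw [← Finset.sum_div, div_div] at this
    simpa using this
  · intro g₁ g₂
    rw [key (fun x => f' (g₁ * x * g₂))]
    have := avg n (fun i => (∑ j, f' (g₁ * (a i * b j) * g₂)) / m) c' ε' hn (fun i => by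
      simpa [mul_assoc] using hb (g₁ * a i) g₂)
    rw [← Finset.sum_div, div_div] at this
    simpa [mul_comm] using this

theorem dist_le_of_approx {f f' : Γ → ℂ} {c c' : ℂ} {ε ε' η : ℝ}
    (h : IsApproxMean f c ε) (h' : IsApproxMean f' c' ε') (hη : ∀ g, ‖f g - f' g‖ ≤ η) :
    ‖c - c'‖ ≤ ε + ε' + η := by
  obtain ⟨n, hn, l, h1, h2⟩ := common h h'
  have hnR : (0 : ℝ) < n := by exact_mod_cast hn
  have a1 := (h1 1 1).le
  have a2 := (h2 1 1).le
  set S := (∑ j, f (1 * l j * 1)) / (n : ℂ)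
  set S' := (∑ j, f' (1 * l j * 1)) / (n : ℂ)
  have a3 : ‖S - S'‖ ≤ η := by
    have : S - S' = (∑ j, (f (1 * l j * 1) - f' (1 * l j * 1))) / (n : ℂ) := by
      rw [Finset.sum_sub_distrib, sub_div]
    rw [this, norm_div, Complex.norm_natCast, div_le_iff₀ hnR]
    calc _ ≤ ∑ j, ‖f (1 * l j * 1) - f' (1 * l j * 1)‖ := norm_sum_le _ _
      _ ≤ ∑ _j : Fin n, η := Finset.sum_le_sum (fun j _ => hη _)
      _ = η * n := by simp [mul_comm]
  calc ‖c - c'‖ = ‖-(S - c) + (S' - c') + (S - S')‖ := by congr 1; ring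
    _ ≤ ‖S - c‖ + ‖S' - c'‖ + ‖S - S'‖ := by
      refine (norm_add_le _ _).trans (add_le_add ((norm_add_le _ _).trans ?_) le_rfl)
      rw [norm_neg]
    _ ≤ ε + ε' + η := by linarith

theorem dist_le {f f' : Γ → ℂ} {c c' : ℂ} {η : ℝ}
    (h : IsMeanValue f c) (h' : IsMeanValue f' c') (hη : ∀ g, ‖f g - f' g‖ ≤ η) :
    ‖c - c'‖ ≤ η := by
  refine le_of_forall_pos_le_add fun ε hε => ?_
  have := dist_le_of_approx (h (ε / 2) (by positivity)) (h' (ε / 2) (by positivity)) hη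
  linarith

theorem unique {f : Γ → ℂ} {c c' : ℂ} (h : IsMeanValue f c) (h' : IsMeanValue f c') : c = c' := by
  have := dist_le h h' (η := 0) (fun g => by simp)
  exact sub_eq_zero.mp (norm_le_zero_iff.mp this)

theorem apMean_eq {f : Γ → ℂ} {c : ℂ} (h : IsMeanValue f c) : apMean f = c := by
  have hex : ∃ c, IsMeanValue f c := ⟨c, h⟩
  rw [apMean, dif_pos hex]
  exact unique hex.choose_spec h

theorem add {f f' : Γ → ℂ} {c c' : ℂ} (h : IsMeanValue f c) (h' : IsMeanValue f' c') :
    IsMeanValue (fun g => f g + f' g) (c + c') := by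
  intro ε hε
  obtain ⟨n, hn, l, h1, h2⟩ := common (h (ε / 2) (by positivity)) (h' (ε / 2) (by positivity))
  refine ⟨n, hn, l, fun g₁ g₂ => ?_⟩
  have := (norm_add_le _ _).trans_lt (add_lt_add (h1 g₁ g₂) (h2 g₁ g₂))
  rw [Finset.sum_add_distrib, add_div, add_sub_add_comm]
  linarith

theorem congr {f f' : Γ → ℂ} {c c' : ℂ} (h : IsMeanValue f c) (hf : ∀ g, f' g = f g)
    (hc : c' = c) : IsMeanValue f' c' := by
  rw [hc, funext hf]
  exact h

theorem const (c : ℂ) : IsMeanValue (fun _ : Γ => c) c :=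
  fun ε hε => ⟨1, one_pos, fun _ => 1, fun _ _ => by simpa using hε⟩

theorem const_mul {f : Γ → ℂ} {c : ℂ} (z : ℂ) (h : IsMeanValue f c) :
    IsMeanValue (fun g => z * f g) (z * c) := by
  intro ε hε
  obtain ⟨n, hn, l, hl⟩ := h (ε / (‖z‖ + 1)) (by positivity)
  refine ⟨n, hn, l, fun g₁ g₂ => ?_⟩
  rw [← Finset.mul_sum, mul_div_assoc, ← mul_sub, norm_mul]
  have := hl g₁ g₂
  rw [lt_div_iff₀ (by positivity)] at this
  nlinarith [norm_nonneg z, norm_nonneg ((∑ j, f (g₁ * l j * g₂)) / n - c)]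

theorem star {f : Γ → ℂ} {c : ℂ} (h : IsMeanValue f c) :
    IsMeanValue (fun g => Star.star (f g)) (Star.star c) := by
  intro ε hε
  obtain ⟨n, hn, l, hl⟩ := h ε hε
  refine ⟨n, hn, l, fun g₁ g₂ => ?_⟩
  rw [← norm_star]
  simpa using hl g₁ g₂

theorem comp_mul_right {f : Γ → ℂ} {c : ℂ} (h : IsMeanValue f c) (a : Γ) :
    IsMeanValue (fun g => f (g * a)) c := by
  intro ε hε
  obtain ⟨n, hn, l, hl⟩ := h ε hε
  exact ⟨n, hn, l, fun g₁ g₂ => by simpa [mul_assoc] using hl g₁ (g₂ * a)⟩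

theorem sum {ι : Type*} (s : Finset ι) {f : ι → Γ → ℂ} {c : ι → ℂ}
    (h : ∀ i ∈ s, IsMeanValue (f i) (c i)) :
    IsMeanValue (fun g => ∑ i ∈ s, f i g) (∑ i ∈ s, c i) := by
  classical
  induction s using Finset.induction_on with
  | empty => simpa using const (Γ := Γ) 0
  | insert a s ha ih =>
    simp only [Finset.sum_insert ha]
    exact add (h a (by simp)) (ih fun i hi => h i (by simp [hi]))

theorem le_re {f : Γ → ℂ} {c : ℂ} (h : IsMeanValue f c) {r : ℝ} (hf : ∀ g, r ≤ (f g).re) :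
    r ≤ c.re := by
  refine le_of_forall_pos_le_add fun ε hε => ?_
  obtain ⟨n, hn, l, hl⟩ := h ε hε
  have hnR : (0 : ℝ) < n := by exact_mod_cast hn
  have h1 := (Complex.abs_re_le_norm _).trans (hl 1 1).le
  rw [Complex.sub_re, Complex.div_natCast_re, Complex.re_sum] at h1
  have h2 : r ≤ (∑ j, (f (1 * l j * 1)).re) / n := by
    rw [le_div_iff₀ hnR]
    calc r * n = ∑ _j : Fin n, r := by simp [mul_comm]
      _ ≤ _ := Finset.sum_le_sum fun j _ => hf _
  have := (abs_le.mp h1).2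
  linarith

theorem nonneg {f : Γ → ℂ} {c : ℂ} (h : IsMeanValue f c) (hf : ∀ g, 0 ≤ f g) : 0 ≤ c := by
  have h1 : Star.star c = c := by
    refine unique (f := f) ?_ h
    have := star h
    have e : (fun g => Star.star (f g)) = f := by
      funext g
      exact (IsSelfAdjoint.of_nonneg (hf g)).star_eq
    rwa [e] at this
  rw [Complex.nonneg_iff]
  refine ⟨le_re h fun g => (Complex.nonneg_iff.mp (hf g)).1, ?_⟩
  exact (Complex.conj_eq_iff_im.mp h1).symm

/-- The mean is faithful on nonnegative almost periodic functions. -/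
theorem eq_zero {f : Γ → ℂ} (hap : IsAlmostPeriodic f) (h : IsMeanValue f 0)
    (hf : ∀ g, 0 ≤ f g) (g₀ : Γ) : f g₀ = 0 := by
  by_contra hne
  have hpos : 0 < (f g₀).re := by
    rcases lt_or_eq_of_le (Complex.nonneg_iff.mp (hf g₀)).1 with h0 | h0
    · exact h0
    · exact absurd (Complex.ext h0.symm (Complex.nonneg_iff.mp (hf g₀)).2.symm) hne
  obtain ⟨t, ht⟩ := hap ((f g₀).re / 2) (by positivity)
  have hs := sum t (f := fun k g => f (g * k)) (c := fun _ => 0)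
    fun k _ => comp_mul_right h k
  have := le_re hs (r := (f g₀).re / 2) (fun g => by
    obtain ⟨k, hk, hk'⟩ := ht (g⁻¹ * g₀)
    have h1 := (Complex.abs_re_le_norm _).trans (hk' g).le
    rw [mul_inv_cancel_left, Complex.sub_re] at h1
    have h2 := (abs_le.mp h1).2
    rw [Complex.re_sum]
    have h3 : (f (g * k)).re ≤ ∑ i ∈ t, (f (g * i)).re :=
      Finset.single_le_sum (f := fun i => (f (g * i)).re)
        (fun i _ => (Complex.nonneg_iff.mp (hf _)).1) hk
    linarith)
  simp at this
  linarith

end IsMeanValue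

namespace IsAlmostPeriodic

variable {Γ : Type*} [Group Γ]

/-- Finite colourings of `Γ` on whose classes the two-sided translates of `f` vary by at
most `ε`. -/
theorem exists_colouring {f : Γ → ℂ} (hf : IsAlmostPeriodic f) {ε : ℝ} (hε : 0 < ε) :
    ∃ n : ℕ, ∃ col : Γ → Fin n, ∀ h h', col h = col h' →
      ∀ g₁ g₂, ‖f (g₁ * h * g₂) - f (g₁ * h' * g₂)‖ ≤ ε := by
  classical
  obtain ⟨t, ht⟩ := hf (ε / 4) (by positivity)
  choose k hk hk' using ht
  let col : Γ → (t → t) := fun h i => ⟨k (h * i), hk _⟩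
  refine ⟨_, fun h => Fintype.equivFin (t → t) (col h), fun h h' hc g₁ g₂ => ?_⟩
  have hc' : k (h * k g₂) = k (h' * k g₂) :=
    congrArg Subtype.val (congrFun ((Fintype.equivFin (t → t)).injective hc) ⟨k g₂, hk _⟩)
  have e1 := hk' g₂ (g₁ * h)
  have e2 := hk' (h * k g₂) g₁
  have e3 := hk' g₂ (g₁ * h')
  have e4 := hk' (h' * k g₂) g₁
  rw [← hc'] at e4
  rw [← mul_assoc] at e2 e4
  set A := f (g₁ * h * g₂)
  set B := f (g₁ * h * k g₂)
  set C := f (g₁ * k (h * k g₂))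
  set A' := f (g₁ * h' * g₂)
  set B' := f (g₁ * h' * k g₂)
  calc ‖A - A'‖ = ‖((A - B) + (B - C)) + (-(A' - B') + -(B' - C))‖ := by congr 1; ring
    _ ≤ (‖A - B‖ + ‖B - C‖) + (‖A' - B'‖ + ‖B' - C‖) := by
      refine (norm_add_le _ _).trans (add_le_add (norm_add_le _ _) ?_)
      refine (norm_add_le _ _).trans ?_
      rw [norm_neg, norm_neg]
    _ ≤ ε := by linarith

theorem exists_approx {f : Γ → ℂ} (hf : IsAlmostPeriodic f) {ε : ℝ} (hε : 0 < ε) :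
    ∃ c, IsApproxMean f c ε := by
  classical
  have hex := exists_colouring hf (ε := ε / 4) (by positivity)
  set n := Nat.find hex with hn_def
  obtain ⟨col, hcol⟩ := Nat.find_spec hex
  have hmin : ∀ (κ : Type) [Fintype κ] (c : Γ → κ), (∀ h h', c h = c h' →
      ∀ g₁ g₂, ‖f (g₁ * h * g₂) - f (g₁ * h' * g₂)‖ ≤ ε / 4) → n ≤ Fintype.card κ := by
    intro κ _ c hc
    refine Nat.find_min' hex ⟨fun h => Fintype.equivFin κ (c h), fun h h' e => ?_⟩
    exact hc h h' ((Fintype.equivFin κ).injective e)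
  have hall : ∀ x y : Γ, ∃ σ : Fin n → Fin n, Function.Bijective σ ∧
      ∀ i, ∃ h, col h = i ∧ col (x * h * y) = σ i := by
    intro x y
    let t : Fin n → Finset (Fin n) := fun i =>
      Finset.univ.filter fun j => ∃ h, col h = i ∧ col (x * h * y) = j
    have hcard : ∀ s : Finset (Fin n), s.card ≤ (s.biUnion t).card := by
      intro s
      have key := hmin ({i // i ∉ s} ⊕ {j // j ∈ s.biUnion t})
        (fun h => if hs : col h ∈ s then
            Sum.inr ⟨col (x * h * y), Finset.mem_biUnion.mpr ⟨col h, hs, by simp [t]; exact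
              ⟨h, rfl, rfl⟩⟩⟩
          else Sum.inl ⟨col h, hs⟩) (by
        intro h h' e g₁ g₂
        by_cases hs : col h ∈ s <;> by_cases hs' : col h' ∈ s <;> simp [hs, hs'] at e
        · have := hcol _ _ e (g₁ * x⁻¹) (y⁻¹ * g₂)
          simpa [mul_assoc] using this
        · exact hcol _ _ e g₁ g₂)
      rw [Fintype.card_sum, Fintype.card_coe, Fintype.card_subtype_compl, Fintype.card_fin,
        Fintype.card_coe] at key
      have : s.card ≤ n := by simpa using s.card_le_univ
      omega
    obtain ⟨σ, hσ, hσ'⟩ := (Finset.all_card_le_biUnion_card_iff_exists_injective t).mp hcard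
    refine ⟨σ, Finite.injective_iff_bijective.mp hσ, fun i => ?_⟩
    simpa [t] using hσ' i
  have hr : ∀ i, ∃ r, col r = i := fun i => by
    obtain ⟨σ, -, h⟩ := hall 1 1
    exact ⟨_, (h i).choose_spec.1⟩
  choose r hr using hr
  have hn : 0 < n := (col 1).pos
  have hnR : (0 : ℝ) < n := by exact_mod_cast hn
  refine ⟨(∑ j, f (r j)) / n, n, hn, r, fun x y => ?_⟩
  obtain ⟨σ, hσ, hh⟩ := hall x y
  choose h h1 h2 using hh
  have e : ∑ j, f (r j) = ∑ j, f (r (σ j)) :=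
    (Equiv.sum_comp (Equiv.ofBijective σ hσ) fun j => f (r j)).symm
  rw [e, ← sub_div, ← Finset.sum_sub_distrib, norm_div, Complex.norm_natCast, div_lt_iff₀ hnR]
  have hb : ∀ j, ‖f (x * r j * y) - f (r (σ j))‖ ≤ ε / 2 := by
    intro j
    have b1 := hcol (r j) (h j) (by rw [hr, h1]) x y
    have b2 := hcol (x * h j * y) (r (σ j)) (by rw [h2, hr]) 1 1
    simp only [one_mul, mul_one] at b2
    calc _ = ‖(f (x * r j * y) - f (x * h j * y)) + (f (x * h j * y) - f (r (σ j)))‖ := by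
          congr 1; ring
      _ ≤ _ := norm_add_le _ _
      _ ≤ ε / 2 := by linarith
  calc _ ≤ ∑ j, ‖f (x * r j * y) - f (r (σ j))‖ := norm_sum_le _ _
    _ ≤ ∑ _j : Fin n, ε / 2 := Finset.sum_le_sum fun j _ => hb j
    _ = ε / 2 * n := by simp [mul_comm]
    _ < ε * n := by nlinarith

/-- Existence of the mean of an almost periodic function. -/
theorem isMeanValue_apMean {f : Γ → ℂ} (hf : IsAlmostPeriodic f) :
    IsMeanValue f (apMean f) := by
  have hex : ∃ c, IsMeanValue f c := by
    have hpos : ∀ k : ℕ, (0 : ℝ) < 1 / (k + 1) := fun k => Nat.one_div_pos_of_nat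
    choose c hc using fun k : ℕ => exists_approx hf (hpos k)
    have hd : ∀ k l, ‖c k - c l‖ ≤ 1 / ((k : ℝ) + 1) + 1 / ((l : ℝ) + 1) := fun k l => by
      simpa using IsMeanValue.dist_le_of_approx (hc k) (hc l) (η := 0) (fun g => by simp)
    have hcau : CauchySeq c := by
      refine Metric.cauchySeq_iff'.mpr fun ε hε => ?_
      obtain ⟨N, hN⟩ := exists_nat_one_div_lt (half_pos hε)
      refine ⟨N, fun k hk => ?_⟩
      rw [dist_eq_norm]
      have : 1 / ((k : ℝ) + 1) ≤ 1 / ((N : ℝ) + 1) := Nat.one_div_le_one_div hk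
      linarith [hd k N]
    obtain ⟨d, hdl⟩ := cauchySeq_tendsto_of_complete hcau
    refine ⟨d, fun ε hε => ?_⟩
    obtain ⟨N, hN⟩ := Metric.tendsto_atTop.mp hdl (ε / 2) (by positivity)
    obtain ⟨N', hN'⟩ := exists_nat_one_div_lt (half_pos hε)
    have hle : 1 / (((max N N' : ℕ) : ℝ) + 1) ≤ 1 / ((N' : ℝ) + 1) :=
      Nat.one_div_le_one_div (le_max_right _ _)
    obtain ⟨n, hn, l, hl⟩ := hc (max N N')
    refine ⟨n, hn, l, fun g₁ g₂ => ?_⟩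
    have h1 := hl g₁ g₂
    have h2 := hN _ (le_max_left N N')
    rw [dist_eq_norm] at h2
    calc _ = ‖((∑ j, f (g₁ * l j * g₂)) / n - c (max N N')) + (c (max N N') - d)‖ := by
          congr 1; ring
      _ ≤ _ := norm_add_le _ _
      _ < ε := by linarith
  rw [apMean, dif_pos hex]
  exact hex.choose_spec

end IsAlmostPeriodic

/-! ### Lyapunov stable actions, invariant functions, averaging -/

/-- Lyapunov stability of an action of `Γ` on a metric space. -/
class LyapunovStable (Γ X : Type*) [Group Γ] [MetricSpace X] [MulAction Γ X] : Prop where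
  stable : ∀ ε > (0 : ℝ), ∀ x : X, ∃ δ > (0 : ℝ), ∀ y : X, dist x y < δ →
    ∀ g : Γ, dist (g • x) (g • y) < ε

/-- The algebra `C_Γ(X)` of continuous complex functions that are constant on orbits. -/
def invariantFunctions (Γ X : Type*) [Group Γ] [TopologicalSpace X] [MulAction Γ X] :
    StarSubalgebra ℂ C(X, ℂ) where
  carrier := {f | ∀ (g : Γ) (x : X), f (g • x) = f x}
  mul_mem' hf hg γ x := by simp [hf γ x, hg γ x]
  add_mem' hf hg γ x := by simp [hf γ x, hg γ x]
  algebraMap_mem' r γ x := by simp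
  star_mem' hf γ x := by simp [hf γ x]

section Averaging

variable {Γ X : Type*} [Group Γ] [MetricSpace X] [CompactSpace X] [MulAction Γ X]

instance isClosed_invariantFunctions :
    IsClosed (invariantFunctions Γ X : Set C(X, ℂ)) := by
  have : (invariantFunctions Γ X : Set C(X, ℂ)) =
      ⋂ (g : Γ) (x : X), {f : C(X, ℂ) | f (g • x) = f x} := by
    ext f
    simp only [Set.mem_iInter, Set.mem_ofPred_eq]
    exact Iff.rfl
  rw [this]
  exact isClosed_iInter fun g => isClosed_iInter fun x =>
    isClosed_eq (continuous_eval_const _) (continuous_eval_const _)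

/-- The pointwise order. -/
noncomputable instance : PartialOrder (invariantFunctions Γ X) := inferInstance

instance : StarOrderedRing (invariantFunctions Γ X) := by
  refine StarOrderedRing.of_nonneg_iff' (fun {a b} hab c => ?_) fun a => ⟨fun ha => ?_, ?_⟩
  · exact fun x => add_le_add (le_refl ((c : C(X, ℂ)) x)) (hab x)
  · have ha' : ∀ x, 0 ≤ (a : C(X, ℂ)) x := fun x => ha x
    refine ⟨⟨⟨fun x => (Real.sqrt ((a : C(X, ℂ)) x).re : ℂ), by fun_prop⟩, fun g x => ?_⟩, ?_⟩
    · have := a.2 g x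
      simp only [ContinuousMap.coe_mk]
      rw [this]
    · ext x
      have h0 := Complex.nonneg_iff.mp (ha' x)
      change (a : C(X, ℂ)) x = Star.star (Real.sqrt ((a : C(X, ℂ)) x).re : ℂ) *
        (Real.sqrt ((a : C(X, ℂ)) x).re : ℂ)
      rw [Complex.star_def, Complex.conj_ofReal, ← Complex.ofReal_mul, Real.mul_self_sqrt h0.1]
      exact Complex.ext rfl h0.2.symm
  · rintro ⟨s, rfl⟩ x
    exact star_mul_self_nonneg ((s : C(X, ℂ)) x)

variable [LyapunovStable Γ X]

theorem LyapunovStable.uniform (φ : C(X, ℂ)) {ε : ℝ} (hε : 0 < ε) :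
    ∃ δ > (0 : ℝ), ∀ x y : X, dist x y < δ → ∀ g : Γ, ‖φ (g • x) - φ (g • y)‖ < ε := by
  have heq : Equicontinuous fun (g : Γ) (x : X) => g • x := by
    intro x
    rw [Metric.equicontinuousAt_iff]
    intro η hη
    obtain ⟨δ, hδ, h⟩ := LyapunovStable.stable (Γ := Γ) η hη x
    exact ⟨δ, hδ, fun y hy g => h y (by rwa [dist_comm]) g⟩
  have huni := CompactSpace.uniformEquicontinuous_of_equicontinuous heq
  rw [Metric.uniformEquicontinuous_iff] at huni
  obtain ⟨η, hη, h1⟩ := Metric.uniformContinuous_iff.mp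
    (CompactSpace.uniformContinuous_of_continuous φ.continuous) ε hε
  obtain ⟨δ, hδ, h2⟩ := huni η hη
  exact ⟨δ, hδ, fun x y hxy g => by simpa [dist_eq_norm] using h1 (h2 x y hxy g)⟩

variable (Γ) in
theorem LyapunovStable.isAlmostPeriodic (φ : C(X, ℂ)) (x : X) :
    IsAlmostPeriodic fun g : Γ => φ (g • x) := by
  classical
  intro ε hε
  obtain ⟨δ, hδ, h⟩ := LyapunovStable.uniform (Γ := Γ) φ hε
  have htb : TotallyBounded (Set.range fun g : Γ => g • x) :=
    isCompact_univ.totallyBounded.subset (Set.subset_univ _)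
  obtain ⟨t, ht, htf, hcov⟩ := Metric.finite_approx_of_totallyBounded htb δ hδ
  choose k hk using fun y : X => show ∃ k : Γ, y ∈ t → k • x = y from by
    by_cases hy : y ∈ t
    · obtain ⟨k, hk⟩ := ht hy
      exact ⟨k, fun _ => hk⟩
    · exact ⟨1, fun h => absurd h hy⟩
  refine ⟨htf.toFinset.image k, fun g => ?_⟩
  have hg := hcov (Set.mem_range_self g)
  simp only [Set.mem_iUnion, Metric.mem_ball] at hg
  obtain ⟨y, hy, hgy⟩ := hg
  refine ⟨k y, Finset.mem_image_of_mem k (by simpa using hy), fun a => ?_⟩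
  simp only [mul_smul, hk y hy]
  exact h _ _ hgy a

variable (Γ) in
theorem LyapunovStable.isMeanValue (φ : C(X, ℂ)) (x : X) :
    IsMeanValue (fun g : Γ => φ (g • x)) (apMean fun g : Γ => φ (g • x)) :=
  (LyapunovStable.isAlmostPeriodic Γ φ x).isMeanValue_apMean

variable (Γ) in
/-- The averaging map `E_Γ : C(X) → C_Γ(X)`, `E_Γ(φ)(x) = M(φ_x)` with `φ_x(g) = φ(gx)`. -/
noncomputable def orbitAverage (φ : C(X, ℂ)) : invariantFunctions Γ X :=
  ⟨⟨fun x => apMean fun g : Γ => φ (g • x), by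
      rw [Metric.continuous_iff]
      intro x ε hε
      obtain ⟨δ, hδ, h⟩ := LyapunovStable.uniform (Γ := Γ) φ (half_pos hε)
      refine ⟨δ, hδ, fun y hy => ?_⟩
      rw [dist_eq_norm]
      have := IsMeanValue.dist_le (LyapunovStable.isMeanValue Γ φ y)
        (LyapunovStable.isMeanValue Γ φ x) (fun g => (h y x hy g).le)
      linarith⟩, by
    intro g x
    simp only [ContinuousMap.coe_mk]
    refine IsMeanValue.apMean_eq ?_
    simpa [mul_smul] using (LyapunovStable.isMeanValue Γ φ x).comp_mul_right g⟩

theorem orbitAverage_apply (φ : C(X, ℂ)) (x : X) :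
    (orbitAverage Γ φ : C(X, ℂ)) x = apMean fun g : Γ => φ (g • x) := rfl

end Averaging

/-! ### The pre-Hilbert module `C(X)` over `C_Γ(X)` -/

/-- `C(X)`, as it carries the `C_Γ(X)`-valued inner product and the norm induced by it. -/
def PreModule (_Γ X : Type*) [TopologicalSpace X] : Type _ := C(X, ℂ)

namespace PreModule

variable (Γ X : Type*) [Group Γ] [MetricSpace X] [CompactSpace X] [MulAction Γ X]

noncomputable instance : AddCommGroup (PreModule Γ X) := inferInstanceAs (AddCommGroup C(X, ℂ))

noncomputable instance : Module ℂ (PreModule Γ X) := inferInstanceAs (Module ℂ C(X, ℂ))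

/-- `C_Γ(X)` acts on `C(X)` by multiplication. -/
noncomputable instance : Module (invariantFunctions Γ X) (PreModule Γ X) :=
  inferInstanceAs (Module (invariantFunctions Γ X) C(X, ℂ))

instance : IsScalarTower ℂ (invariantFunctions Γ X) (PreModule Γ X) where
  smul_assoc z a φ := smul_mul_assoc z (a : C(X, ℂ)) (show C(X, ℂ) from φ)

variable {Γ X}

/-- The underlying continuous function. -/
def toFn (φ : PreModule Γ X) : C(X, ℂ) := φ

variable [LyapunovStable Γ X]

/-- The inner product `⟪ψ, φ⟫(x) = M(φ_x * conj ψ_x)`; as always in Mathlib, it is linear in the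
second variable. -/
noncomputable instance : Inner (invariantFunctions Γ X) (PreModule Γ X) where
  inner ψ φ := orbitAverage Γ (star ψ.toFn * φ.toFn)

theorem inner_apply (ψ φ : PreModule Γ X) (x : X) :
    (inner (invariantFunctions Γ X) ψ φ : C(X, ℂ)) x =
      apMean fun g : Γ => star (ψ.toFn (g • x)) * φ.toFn (g • x) := rfl

theorem isMeanValue_inner (ψ φ : PreModule Γ X) (x : X) :
    IsMeanValue (fun g : Γ => star (ψ.toFn (g • x)) * φ.toFn (g • x))
      ((inner (invariantFunctions Γ X) ψ φ : C(X, ℂ)) x) :=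
  LyapunovStable.isMeanValue Γ (star ψ.toFn * φ.toFn) x

theorem inner_ext {ψ φ : PreModule Γ X} {a : invariantFunctions Γ X}
    (h : ∀ x, IsMeanValue (fun g : Γ => star (ψ.toFn (g • x)) * φ.toFn (g • x))
      ((a : C(X, ℂ)) x)) : inner (invariantFunctions Γ X) ψ φ = a :=
  Subtype.ext <| ContinuousMap.ext fun x => (isMeanValue_inner ψ φ x).unique (h x)

variable (Γ X) in
/-- The norm `‖φ‖ = ‖⟪φ, φ⟫‖ ^ (1 / 2)`. -/
noncomputable instance : Norm (PreModule Γ X) := CStarModule.norm (invariantFunctions Γ X)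

noncomputable instance : CStarModule (invariantFunctions Γ X) (PreModule Γ X) where
  inner_add_right {ψ φ φ'} := inner_ext fun x =>
    ((isMeanValue_inner ψ φ x).add (isMeanValue_inner ψ φ' x)).congr
      (fun _ => mul_add _ _ _) rfl
  inner_self_nonneg {φ} := fun x =>
    (isMeanValue_inner φ φ x).nonneg fun g => star_mul_self_nonneg (φ.toFn (g • x))
  inner_self {φ} := by
    constructor
    · intro h
      refine ContinuousMap.ext (f := φ.toFn) (g := 0) fun x => ?_
      have hm := isMeanValue_inner φ φ x
      rw [h] at hm
      have := hm.eq_zero (LyapunovStable.isAlmostPeriodic Γ (star φ.toFn * φ.toFn) x)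
        (fun g => star_mul_self_nonneg (φ.toFn (g • x))) 1
      simpa using this
    · rintro rfl
      exact inner_ext fun x => (IsMeanValue.const 0).congr (fun _ => mul_zero _) rfl
  inner_op_smul_right {a ψ φ} := inner_ext fun x =>
    ((isMeanValue_inner ψ φ x).const_mul ((a : C(X, ℂ)) x)).congr (fun g => by
      change star (ψ.toFn (g • x)) * ((a : C(X, ℂ)) (g • x) * φ.toFn (g • x)) = _
      rw [a.2 g x, mul_left_comm]) rfl
  inner_smul_right_complex {z ψ φ} := inner_ext fun x =>
    ((isMeanValue_inner ψ φ x).const_mul z).congr (fun g => by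
      change star (ψ.toFn (g • x)) * (z * φ.toFn (g • x)) = _
      rw [mul_left_comm]) rfl
  star_inner ψ φ := (inner_ext fun x =>
    (isMeanValue_inner ψ φ x).star.congr (fun g => by
      rw [star_mul, star_star]) rfl).symm
  norm_eq_sqrt_norm_inner_self _ := rfl

variable (Γ X)

noncomputable instance : NormedAddCommGroup (PreModule Γ X) :=
  NormedAddCommGroup.ofCore (CStarModule.normedSpaceCore (invariantFunctions Γ X))

noncomputable instance : NormedSpace ℂ (PreModule Γ X) :=
  NormedSpace.ofCore (CStarModule.normedSpaceCore (invariantFunctions Γ X))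

instance : IsBoundedSMul (invariantFunctions Γ X) (PreModule Γ X) := by
  refine IsBoundedSMul.of_norm_smul_le fun a φ => ?_
  refine (sq_le_sq₀ (norm_nonneg _) (by positivity)).mp ?_
  rw [mul_pow, CStarModule.norm_sq_eq (invariantFunctions Γ X) (x := a • φ),
    CStarModule.norm_sq_eq (invariantFunctions Γ X) (x := φ), CStarModule.inner_op_smul_right,
    CStarModule.inner_op_smul_left]
  calc _ ≤ ‖a‖ * (‖inner (invariantFunctions Γ X) φ φ‖ * ‖star a‖) :=
        (norm_mul_le _ _).trans (mul_le_mul_of_nonneg_left (norm_mul_le _ _) (norm_nonneg _))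
    _ = _ := by
      have : ‖star a‖ = ‖a‖ := norm_star (a : C(X, ℂ))
      rw [this]
      ring

end PreModule

/-! ### Completion of a pre-Hilbert module -/

section Completion

open UniformSpace

variable {A E : Type*} [CStarAlgebra A] [PartialOrder A] [StarOrderedRing A]
  [NormedAddCommGroup E] [NormedSpace ℂ E] [Module A E] [CStarModule A E]

theorem cstarModule_completion_inner_coe (x y : E) :
    inner A (x : Completion E) (y : Completion E) = inner A x y :=
  (Completion.isDenseInducing_coe.prodMap Completion.isDenseInducing_coe).extend_eq
    (f := Function.uncurry (inner A)) CStarModule.continuous_inner (x, y)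

theorem cstarModule_completion_continuous_inner :
    Continuous (fun p : Completion E × Completion E => inner A p.1 p.2) := by
  let inner' : E →+ E →+ A :=
    { toFun := fun x => (CStarModule.innerₛₗ (A := A) x).toAddMonoidHom
      map_zero' := by ext x; exact CStarModule.inner_zero_left
      map_add' := fun x y => by ext z; exact CStarModule.inner_add_left }
  have : Continuous fun p : E × E => inner' p.1 p.2 := CStarModule.continuous_inner
  exact (Completion.isDenseInducing_toCompl E).extend_Z_bilin
    (Completion.isDenseInducing_toCompl E) this

/-- The inner product of a pre-Hilbert module, extended by continuity to the completion, makes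
the completion a Hilbert module. -/
noncomputable instance cstarModuleCompletion [UniformContinuousConstSMul A E] :
    CStarModule A (Completion E) where
  inner_add_right {x y z} := by
    have hc := cstarModule_completion_continuous_inner (A := A) (E := E)
    refine Completion.induction_on₃ x y z (isClosed_eq ?_ ?_) fun a b c => ?_
    · exact hc.comp (continuous_fst.prodMk (by fun_prop))
    · exact (hc.comp (continuous_fst.prodMk (by fun_prop))).add
        (hc.comp (continuous_fst.prodMk (by fun_prop)))
    · simp only [← Completion.coe_add, cstarModule_completion_inner_coe,
        CStarModule.inner_add_right]
  inner_self_nonneg {x} := by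
    have hc := cstarModule_completion_continuous_inner (A := A) (E := E)
    refine Completion.induction_on x (isClosed_le continuous_const
      (hc.comp (continuous_id.prodMk continuous_id))) fun a => ?_
    simp only [cstarModule_completion_inner_coe,
      CStarModule.inner_self_nonneg]
  inner_self {x} := by
    have hc := cstarModule_completion_continuous_inner (A := A) (E := E)
    have hn : ‖x‖ ^ 2 = ‖inner A x x‖ := by
      refine Completion.induction_on x (isClosed_eq (by fun_prop)
        (hc.comp (continuous_id.prodMk continuous_id)).norm) fun a => ?_
      simp only [cstarModule_completion_inner_coe, Completion.norm_coe,
        CStarModule.norm_sq_eq A]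
    rw [← norm_eq_zero, ← hn]
    simp
  inner_op_smul_right {a x y} := by
    have hc := cstarModule_completion_continuous_inner (A := A) (E := E)
    refine Completion.induction_on₂ x y (isClosed_eq ?_ ?_) fun b c => ?_
    · exact hc.comp (continuous_fst.prodMk (continuous_snd.const_smul a))
    · exact continuous_const.mul hc
    · simp only [← Completion.coe_smul, cstarModule_completion_inner_coe,
        CStarModule.inner_op_smul_right]
  inner_smul_right_complex {a x y} := by
    have hc := cstarModule_completion_continuous_inner (A := A) (E := E)
    refine Completion.induction_on₂ x y (isClosed_eq ?_ ?_) fun b c => ?_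
    · exact hc.comp (continuous_fst.prodMk (continuous_snd.const_smul a))
    · exact hc.const_smul a
    · simp only [← Completion.coe_smul, cstarModule_completion_inner_coe,
        CStarModule.inner_smul_right_complex]
  star_inner x y := by
    have hc := cstarModule_completion_continuous_inner (A := A) (E := E)
    refine Completion.induction_on₂ x y (isClosed_eq ?_ ?_) fun b c => ?_
    · exact hc.star
    · exact hc.comp (continuous_snd.prodMk continuous_fst)
    · simp only [cstarModule_completion_inner_coe, CStarModule.star_inner]
  norm_eq_sqrt_norm_inner_self x := by
    have hc := cstarModule_completion_continuous_inner (A := A) (E := E)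
    refine Completion.induction_on x (isClosed_eq (by fun_prop)
      (hc.comp (continuous_id.prodMk continuous_id)).norm.sqrt) fun a => ?_
    simp only [cstarModule_completion_inner_coe, Completion.norm_coe,
      CStarModule.norm_eq_sqrt_norm_inner_self (A := A) a]

end Completion

/-- The Hilbert `C_Γ(X)`-module `L_Γ(X)`: the completion of `C(X)` for the norm given by the inner
product `⟪ψ, φ⟫(x) = M(φ_x * conj ψ_x)`. -/
abbrev LGamma (Γ X : Type*) [Group Γ] [MetricSpace X] [CompactSpace X] [MulAction Γ X]
    [LyapunovStable Γ X] : Type _ :=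
  UniformSpace.Completion (PreModule Γ X)

/-! ### The dual module and C*-reflexivity -/

section Reflexive

variable (A E : Type*) [CommCStarAlgebra A] [NormedAddCommGroup E] [NormedSpace ℂ E] [Module A E]

/-- The `A`-dual module `E'`: all bounded `A`-linear maps `E → A`, with the operator norm and the
pointwise `A`-module structure. -/
noncomputable def cstarDual : Submodule A (E →L[ℂ] A) where
  carrier := {f | ∀ (a : A) (x : E), f (a • x) = a * f x}
  add_mem' hf hg a x := by simp [hf a x, hg a x, mul_add]
  zero_mem' a x := by simp
  smul_mem' b f hf a x := by simp [hf a x, mul_left_comm]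

/-- The canonical map `E → E''`, `x ↦ (f ↦ f x)`. -/
noncomputable def toCStarBidual (x : E) : cstarDual A (cstarDual A E) :=
  ⟨(ContinuousLinearMap.apply ℂ A x).comp
      ((cstarDual A E).restrictScalars ℂ).subtypeL, fun _ _ => rfl⟩

/-- A Hilbert module `E` over the commutative C*-algebra `A` is C*-reflexive if the canonical map
`E → E''` is bijective. (Some authors give `E'` the conjugate module structure and use the map
`x ↦ (f ↦ star (f x))`; over a commutative algebra the two bidual modules correspond to each other
through `F ↦ star ∘ F`, and so do the two canonical maps.) -/
def CStarReflexive [PartialOrder A] [CStarModule A E] [CompleteSpace E] : Prop :=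
  Function.Bijective (toCStarBidual A E)

end Reflexive

/-!
The module `L_Γ(X)` is separable, since `C(X)` is separable in the uniform norm, which dominates
the norm of the module, and `C_Γ(X)`, as a subalgebra of `C(X)`, is separable too. The theorem is
therefore a case of `cstarReflexive_of_separable`: a separable Hilbert module `E` over a separable
commutative unital C*-algebra `A` is C*-reflexive.

By Gelfand duality `A = C(Y)`, where the spectrum `Y` is compact and, by separability of `A`,
metrizable. The heart of the proof is `tendsto_bidual_zero`: if functionals `g n` in `E'` converge
to zero pointwise on `E`, then `F (g n)` converges to zero in norm for every `F` in `E''`. By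
compactness this is a local question at a point `y₀` of `Y`.

* If `y₀` is isolated, with indicator function `p`, then `pE` is a Hilbert space, and its
  reflexivity (Riesz) shows that `F` agrees at `y₀` with the evaluation at an element of `E`
  (`exists_eval_of_isOpen_singleton`).
* Otherwise, were `|F (g n)|` not small near `y₀`, it would be at least `ε` at points `w k ≠ y₀`
  converging to `y₀`, for a subsequence `g (n k)`. With bumps `a k` around `w k` supported in
  disjoint annuli, `f = ∑ a k • g (n k)`, taken over the even `k`, is a bounded functional because
  `g` is pointwise null. As `F` is `A`-linear, `F f` vanishes at `w k` for odd `k` and has modulus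
  at least `ε` there for even `k`, so it is discontinuous at `y₀`
  (`eventually_norm_character_bidual_le`).

Since `E` is separable, there are `A`-linear contractions `R n`, converging strongly to zero, for
which `1 - R n` has finite rank (`exists_residual_tendsto_zero`). Finite rank makes
`F - F (· ∘ R n)` the evaluation at some `z n` in `E`. For functionals `f n` in the unit ball of
`E'` the sequence `f n ∘ R n` is pointwise null, so `F (f n ∘ R n)` tends to zero; hence the
evaluations at `z n` converge to `F` in norm. The canonical map is isometric and `E` is complete,
so `F` is an evaluation.
-/

open WeakDual Filter Topology

/-! ### Characters of a commutative C*-algebra -/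

section CommCStar

variable {A : Type*} [CommCStarAlgebra A]

/-- Characters separate the points of `A`. -/
theorem character_ext {a b : A} (h : ∀ y : characterSpace ℂ A, y a = y b) : a = b :=
  (gelfandTransform_isometry A).injective (ContinuousMap.ext h)

theorem norm_le_of_character_le {a : A} {C : ℝ} (hC : 0 ≤ C)
    (h : ∀ y : characterSpace ℂ A, ‖y a‖ ≤ C) : ‖a‖ ≤ C := by
  have e : ‖gelfandTransform ℂ A a‖ = ‖a‖ :=
    (gelfandTransform_isometry A).norm_map_of_map_zero (map_zero _) a
  rw [← e, ContinuousMap.norm_le _ hC]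
  exact h

theorem norm_character_apply_le (y : characterSpace ℂ A) (a : A) : ‖y a‖ ≤ ‖a‖ := by
  have e : ‖gelfandTransform ℂ A a‖ = ‖a‖ :=
    (gelfandTransform_isometry A).norm_map_of_map_zero (map_zero _) a
  rw [← e]
  exact (gelfandTransform ℂ A a).norm_coe_le_norm y

/-- Gelfand duality: every continuous function on the spectrum comes from an element of `A`. -/
theorem exists_character_apply_eq (φ : C(characterSpace ℂ A, ℂ)) :
    ∃ a : A, ∀ y : characterSpace ℂ A, y a = φ y := by
  obtain ⟨a, rfl⟩ := (gelfandTransform_bijective A).2 φ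
  exact ⟨a, fun _ => rfl⟩

theorem continuous_character_apply (a : A) :
    Continuous fun y : characterSpace ℂ A => y a :=
  (gelfandTransform ℂ A a).continuous

theorem character_map_star (y : characterSpace ℂ A) (a : A) : y (star a) = star (y a) :=
  map_star y a

theorem metrizableSpace_characterSpace [TopologicalSpace.SeparableSpace A] :
    TopologicalSpace.MetrizableSpace (characterSpace ℂ A) :=
  WeakDual.metrizable_of_isCompact ℂ A _ (isCompact_iff_compactSpace.mpr inferInstance)

end CommCStar

/-! ### The dual module -/

section Dual

variable {A E : Type*} [CommCStarAlgebra A] [NormedAddCommGroup E] [NormedSpace ℂ E] [Module A E]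

@[simp]
theorem cstarDual_smul_apply (a : A) (f : cstarDual A E) (x : E) : (a • f).1 x = a * f.1 x := rfl

theorem cstarDual_ext {f g : cstarDual A E} (h : ∀ x, f.1 x = g.1 x) : f = g :=
  Subtype.ext (ContinuousLinearMap.ext h)

end Dual

/-! ### Hilbert modules seen through characters -/

section HilbertModule

variable {A E : Type*} [CommCStarAlgebra A] [PartialOrder A] [StarOrderedRing A]
  [NormedAddCommGroup E] [NormedSpace ℂ E] [Module A E] [CStarModule A E]

theorem character_inner_self_nonneg (y : characterSpace ℂ A) (x : E) :
    0 ≤ y (inner A x x) := by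
  obtain ⟨c, hc⟩ := CStarAlgebra.nonneg_iff_eq_star_mul_self.mp
    (CStarModule.inner_self_nonneg (A := A) (x := x))
  rw [hc, map_mul, character_map_star]
  exact star_mul_self_nonneg _

theorem character_inner_self_re (y : characterSpace ℂ A) (x : E) :
    y (inner A x x) = ((y (inner A x x)).re : ℂ) :=
  Complex.ext rfl (Complex.nonneg_iff.mp (character_inner_self_nonneg y x)).2.symm

theorem norm_character_inner_self (y : characterSpace ℂ A) (x : E) :
    ‖y (inner A x x)‖ = (y (inner A x x)).re := by
  have h := (Complex.nonneg_iff.mp (character_inner_self_nonneg y x)).1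
  conv_lhs => rw [character_inner_self_re, Complex.norm_real, Real.norm_of_nonneg h]

variable (A) in
theorem norm_le_of_character_inner_self_le {x : E} {C : ℝ} (hC : 0 ≤ C)
    (h : ∀ y : characterSpace ℂ A, (y (inner A x x)).re ≤ C ^ 2) : ‖x‖ ≤ C := by
  refine (sq_le_sq₀ (norm_nonneg _) hC).mp ?_
  rw [CStarModule.norm_sq_eq A]
  exact norm_le_of_character_le (sq_nonneg C) fun y => by
    rw [norm_character_inner_self]
    exact h y

theorem character_inner_self_le (y : characterSpace ℂ A) (x : E) :
    (y (inner A x x)).re ≤ ‖x‖ ^ 2 := by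
  rw [← norm_character_inner_self, CStarModule.norm_sq_eq A]
  exact norm_character_apply_le _ _

variable (A) in
omit [StarOrderedRing A] in
theorem CStarModule.ext_inner_left {x y : E} (h : ∀ v, inner A v x = inner A v y) : x = y := by
  rw [← sub_eq_zero, ← CStarModule.inner_self (A := A), CStarModule.inner_sub_right, h, sub_self]

omit [StarOrderedRing A] in
/-- The scalar actions of `ℂ` and `A` on a Hilbert module are compatible, which the axioms do not
include: it follows from nondegeneracy of the inner product. -/
theorem CStarModule.smul_complex_smul (z : ℂ) (a : A) (x : E) : (z • a) • x = z • a • x :=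
  CStarModule.ext_inner_left A fun v => by simp

omit [StarOrderedRing A] in
theorem CStarModule.smul_complex_comm (z : ℂ) (a : A) (x : E) : a • z • x = z • a • x :=
  CStarModule.ext_inner_left A fun v => by simp

theorem CStarModule.norm_op_smul_le (a : A) (x : E) : ‖a • x‖ ≤ ‖a‖ * ‖x‖ := by
  refine norm_le_of_character_inner_self_le A (by positivity) fun y => ?_
  have e : y (inner A (a • x) (a • x)) = ((‖y a‖ ^ 2 * (y (inner A x x)).re : ℝ) : ℂ) := by
    rw [inner_op_smul_right, inner_op_smul_left, map_mul, map_mul, character_map_star,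
      character_inner_self_re y x, mul_left_comm, Complex.star_def, Complex.mul_conj,
      Complex.normSq_eq_norm_sq]
    push_cast
    simp [mul_comm]
  rw [e, Complex.ofReal_re, mul_pow]
  have := norm_character_apply_le y a
  have := character_inner_self_le y x
  have := (Complex.nonneg_iff.mp (character_inner_self_nonneg y x)).1
  gcongr

/-- The functional `⟪x, ·⟫`. -/
noncomputable def innerDual (x : E) : cstarDual A E :=
  ⟨CStarModule.innerSL x, fun _ _ => CStarModule.inner_op_smul_right⟩

@[simp]
theorem innerDual_apply (x v : E) : (innerDual x : cstarDual A E).1 v = inner A x v := rfl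

theorem norm_innerDual_le (x : E) : ‖(innerDual x : cstarDual A E)‖ ≤ ‖x‖ :=
  ContinuousLinearMap.opNorm_le_bound _ (norm_nonneg _) fun _ => CStarModule.norm_inner_le E

theorem innerDual_add (x v : E) : (innerDual (x + v) : cstarDual A E) = innerDual x + innerDual v :=
  Subtype.ext (map_add CStarModule.innerSL x v)

theorem innerDual_smul (z : ℂ) (x : E) :
    (innerDual (z • x) : cstarDual A E) = star z • innerDual x :=
  Subtype.ext (CStarModule.innerSL.map_smulₛₗ z x)

end HilbertModule

/-! ### Contractions differing from the identity by finite rank operators -/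

section Contractions

variable {A E : Type*} [CommCStarAlgebra A] [NormedAddCommGroup E] [NormedSpace ℂ E] [Module A E]

variable (A) in
/-- `R` is an `A`-linear operator which, seen from the bidual, differs from the identity by
evaluations only: for `F` in `E''` the functional `f ↦ F f - F (f ∘ R)` is the evaluation at a
point of `E`. Operators differing from the identity by a finite sum of operators `v ↦ ⟪u, v⟫ • x`
are of this kind. -/
structure IsResidual (R : E →L[ℂ] E) : Prop where
  map_smul : ∀ (a : A) (x : E), R (a • x) = a • R x
  bidual : ∀ F : cstarDual A (cstarDual A E), ∃ z : E, ∀ f h : cstarDual A E,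
    (∀ x, h.1 x = f.1 (R x)) → F.1 f = F.1 h + f.1 z

/-- The functional `f ∘ R`. -/
noncomputable def cstarDualComp (f : cstarDual A E) (R : E →L[ℂ] E)
    (hR : ∀ (a : A) (x : E), R (a • x) = a • R x) : cstarDual A E :=
  ⟨f.1.comp R, fun a x => by
    rw [ContinuousLinearMap.comp_apply, hR]
    exact f.2 a (R x)⟩

@[simp]
theorem cstarDualComp_apply (f : cstarDual A E) (R : E →L[ℂ] E)
    (hR : ∀ (a : A) (x : E), R (a • x) = a • R x) (x : E) :
    (cstarDualComp f R hR).1 x = f.1 (R x) := rfl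

variable (A) in
theorem IsResidual.id : IsResidual A (ContinuousLinearMap.id ℂ E) where
  map_smul _ _ := rfl
  bidual _ := ⟨0, fun f h hfh => by rw [cstarDual_ext (f := h) (g := f) hfh, map_zero, add_zero]⟩

variable [PartialOrder A] [StarOrderedRing A] [CStarModule A E]

/-- Composing with `1 - θ`, where `θ v = (b * ⟪x, v⟫) • x` has rank one, preserves residual
operators. -/
theorem IsResidual.rankOne_comp {R S : E →L[ℂ] E} (hR : IsResidual A R) (b : A) (x : E)
    (hS : ∀ v, S v = R v - (b * inner A x (R v)) • x) : IsResidual A S where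
  map_smul a v := by
    rw [hS, hS, hR.map_smul, CStarModule.inner_op_smul_right, smul_sub, smul_smul]
    congr 2
    ring
  bidual F := by
    obtain ⟨z, hz⟩ := hR.bidual F
    let k : cstarDual A E := cstarDualComp (b • innerDual x) R hR.map_smul
    refine ⟨z + F.1 k • x, fun f h hfh => ?_⟩
    have e : cstarDualComp f R hR.map_smul = h + f.1 x • k := by
      refine cstarDual_ext fun v => ?_
      change f.1 (R v) = h.1 v + f.1 x * (b * inner A x (R v))
      have : f.1 ((b * inner A x (R v)) • x) = _ := f.2 _ x
      rw [hfh, hS, map_sub, this]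
      ring
    have e' : F.1 (f.1 x • k) = f.1 x * F.1 k := F.2 _ k
    have e'' : f.1 (F.1 k • x) = F.1 k * f.1 x := f.2 _ x
    rw [hz f _ (cstarDualComp_apply f R hR.map_smul), e, map_add, map_add, e', e'']
    ring

/-- For `b = (⟪x, x⟫ + η ^ 2)⁻¹` the operator `1 - θ`, `θ v = (b * ⟪x, v⟫) • x`, is a contraction
which maps `x` into the ball of radius `η`. -/
theorem exists_rankOne_contraction (x : E) {η : ℝ} (hη : 0 < η) :
    ∃ b : A, (∀ v : E, ‖v - (b * inner A x v) • x‖ ≤ ‖v‖) ∧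
      ‖x - (b * inner A x x) • x‖ ≤ η := by
  have hpos : ∀ y : characterSpace ℂ A, 0 < (y (inner A x x)).re + η ^ 2 := fun y => by
    have := (Complex.nonneg_iff.mp (character_inner_self_nonneg y x)).1
    positivity
  obtain ⟨b, hb⟩ := exists_character_apply_eq (A := A)
    ⟨fun y => (((y (inner A x x)).re + η ^ 2)⁻¹ : ℝ), by
      have := continuous_character_apply (inner A x x)
      exact Complex.continuous_ofReal.comp
        (((Complex.continuous_re.comp this).add continuous_const).inv₀ fun y => (hpos y).ne')⟩
  simp only [ContinuousMap.coe_mk] at hb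
  have key : ∀ (y : characterSpace ℂ A) (v : E),
      (y (inner A (v - (b * inner A x v) • x) (v - (b * inner A x v) • x))).re =
        (y (inner A v v)).re - 2 * ((y (inner A x x)).re + η ^ 2)⁻¹ * ‖y (inner A x v)‖ ^ 2 +
        (((y (inner A x x)).re + η ^ 2)⁻¹) ^ 2 * (y (inner A x x)).re *
          ‖y (inner A x v)‖ ^ 2 := by
    intro y v
    have e1 : inner A v x = star (inner A x v) := (CStarModule.star_inner x v).symm
    have e2 := character_inner_self_re y x
    have e3 := character_inner_self_re y v
    set σ := (y (inner A x x)).re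
    set τ := (y (inner A v v)).re
    set ξ := y (inner A x v) with hξ
    have e4 : ξ * star ξ = ((‖ξ‖ ^ 2 : ℝ) : ℂ) := by
      rw [Complex.star_def, Complex.mul_conj, Complex.normSq_eq_norm_sq]
    have e5 : y (inner A (v - (b * inner A x v) • x) (v - (b * inner A x v) • x)) =
        ((τ - 2 * (σ + η ^ 2)⁻¹ * ‖ξ‖ ^ 2 + ((σ + η ^ 2)⁻¹) ^ 2 * σ * ‖ξ‖ ^ 2 : ℝ) : ℂ) := by
      simp only [CStarModule.inner_sub_left, CStarModule.inner_sub_right,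
        CStarModule.inner_op_smul_left, CStarModule.inner_op_smul_right, e1, map_sub, map_mul,
        star_mul, character_map_star, hb, e2, e3, ← hξ]
      rw [Complex.star_def, Complex.conj_ofReal, ← Complex.star_def]
      push_cast at e4 ⊢
      linear_combination (-2 * ((σ : ℂ) + η ^ 2)⁻¹ + (((σ : ℂ) + η ^ 2)⁻¹) ^ 2 * σ) * e4
    rw [e5, Complex.ofReal_re]
  refine ⟨b, fun v => ?_, ?_⟩
  · refine norm_le_of_character_inner_self_le A (norm_nonneg _) fun y => ?_
    refine le_trans ?_ (character_inner_self_le y v)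
    rw [key]
    have h0 := (Complex.nonneg_iff.mp (character_inner_self_nonneg y x)).1
    have h1 := hpos y
    set σ := (y (inner A x x)).re
    have h2 : (σ + η ^ 2)⁻¹ * σ ≤ 1 := by
      rw [inv_mul_le_iff₀ h1]
      nlinarith
    have h3 : 0 ≤ (σ + η ^ 2)⁻¹ * ‖y (inner A x v)‖ ^ 2 := by positivity
    nlinarith
  · refine norm_le_of_character_inner_self_le A hη.le fun y => ?_
    have h0 := (Complex.nonneg_iff.mp (character_inner_self_nonneg y x)).1
    have h1 := hpos y
    rw [key, norm_character_inner_self]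
    set σ := (y (inner A x x)).re
    have e : σ - 2 * (σ + η ^ 2)⁻¹ * σ ^ 2 + ((σ + η ^ 2)⁻¹) ^ 2 * σ * σ ^ 2 =
        σ * η ^ 4 / (σ + η ^ 2) ^ 2 := by
      field_simp
      ring
    rw [e, div_le_iff₀ (by positivity)]
    nlinarith [sq_nonneg η, pow_pos hη 4, pow_pos hη 2, mul_nonneg h0 (pow_pos hη 4).le,
      mul_nonneg (sq_nonneg σ) (sq_nonneg η), pow_pos hη 6]

variable (A) in
/-- Residual contractions can be made small on any finite set, by a regularized Gram-Schmidt
process. -/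
theorem exists_residual_contraction (s : Finset E) {η : ℝ} (hη : 0 < η) :
    ∃ R : E →L[ℂ] E, IsResidual A R ∧ (∀ x, ‖R x‖ ≤ ‖x‖) ∧ ∀ x ∈ s, ‖R x‖ ≤ η := by
  classical
  induction s using Finset.induction_on with
  | empty => exact ⟨ContinuousLinearMap.id ℂ E, IsResidual.id A, fun _ => le_rfl, by simp⟩
  | insert x s _ ih =>
    obtain ⟨R, hR, hc, hs⟩ := ih
    obtain ⟨b, hb, hbx⟩ := exists_rankOne_contraction (A := A) (R x) hη
    let S : E →ₗ[ℂ] E :=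
      { toFun := fun v => R v - (b * inner A (R x) (R v)) • R x
        map_add' := fun v w => by
          rw [map_add, CStarModule.inner_add_right, mul_add, add_smul]
          abel
        map_smul' := fun z v => by
          rw [map_smul, CStarModule.inner_smul_right_complex, mul_smul_comm,
            CStarModule.smul_complex_smul, RingHom.id_apply, smul_sub] }
    have hS : ∀ v, ‖S v‖ ≤ ‖R v‖ := fun v => hb (R v)
    refine ⟨S.mkContinuous 1 fun v => by simpa using (hS v).trans (hc v),
      hR.rankOne_comp b (R x) fun v => rfl, fun v => (hS v).trans (hc v), fun v hv => ?_⟩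
    rcases Finset.mem_insert.mp hv with rfl | hv
    · exact hbx
    · exact (hS v).trans (hs v hv)

variable (A E) in
/-- On a separable Hilbert module there are residual contractions converging strongly to zero. -/
theorem exists_residual_tendsto_zero [TopologicalSpace.SeparableSpace E] :
    ∃ R : ℕ → E →L[ℂ] E, (∀ n, IsResidual A (R n)) ∧ (∀ n x, ‖R n x‖ ≤ ‖x‖) ∧
      ∀ x, Tendsto (fun n => R n x) atTop (𝓝 0) := by
  classical
  obtain ⟨u, hu⟩ := TopologicalSpace.exists_dense_seq E
  choose R hR hc hs using fun n : ℕ => exists_residual_contraction A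
    ((Finset.range n).image u) (Nat.one_div_pos_of_nat (α := ℝ) (n := n))
  refine ⟨R, hR, hc, fun x => Metric.tendsto_atTop.mpr fun ε hε => ?_⟩
  obtain ⟨_, hx, i, rfl⟩ := Metric.dense_iff.mp hu x (ε / 2) (half_pos hε)
  obtain ⟨N, hN⟩ := exists_nat_one_div_lt (half_pos hε)
  refine ⟨max N (i + 1), fun n hn => ?_⟩
  have h1 : ‖R n (x - u i)‖ < ε / 2 := by
    refine (hc n _).trans_lt ?_
    rwa [← dist_eq_norm, dist_comm]
  have h2 : ‖R n (u i)‖ < ε / 2 := by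
    refine (hs n (u i) (Finset.mem_image_of_mem u (Finset.mem_range.mpr ?_))).trans_lt
      ((Nat.one_div_le_one_div ((le_max_left _ _).trans hn)).trans_lt hN)
    exact (le_max_right N (i + 1)).trans hn
  have h3 : R n x = R n (x - u i) + R n (u i) := by rw [← map_add, sub_add_cancel]
  rw [dist_zero_right, h3]
  exact (norm_add_le _ _).trans_lt (by linarith)

end Contractions

/-! ### Isolated points of the spectrum -/

section IsolatedPoint

variable {A E : Type*} [CommCStarAlgebra A] [PartialOrder A] [StarOrderedRing A]
  [NormedAddCommGroup E] [NormedSpace ℂ E] [Module A E] [CStarModule A E]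

/-- The operator `x ↦ a • x`. -/
noncomputable def opSMulL (a : A) : E →L[ℂ] E :=
  LinearMap.mkContinuous
    { toFun := fun x => a • x
      map_add' := smul_add a
      map_smul' := fun z x => CStarModule.smul_complex_comm z a x }
    ‖a‖ fun x => CStarModule.norm_op_smul_le a x

/-- Over an isolated point `y` of the spectrum the module is a Hilbert space, hence reflexive:
at `y`, every element of the bidual agrees with an evaluation. -/
theorem exists_eval_of_isOpen_singleton [CompleteSpace E] {y : characterSpace ℂ A}
    (hy : IsOpen {y}) (F : cstarDual A (cstarDual A E)) :
    ∃ h : E, ∀ f : cstarDual A E, y (F.1 f) = y (f.1 h) := by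
  classical
  -- `p` is the indicator function of the isolated point.
  obtain ⟨p, hp⟩ := exists_character_apply_eq (A := A)
    ⟨fun t => if t = y then 1 else 0, by
      refine continuous_const.if (fun t ht => ?_) continuous_const
      have : IsClopen {t | t = y} := ⟨isClosed_singleton, hy⟩
      rw [this.frontier_eq] at ht
      exact ht.elim⟩
  simp only [ContinuousMap.coe_mk] at hp
  have hpy : y p = 1 := by simp [hp]
  have hpa : ∀ a : A, p * a = y a • p := fun a => character_ext fun t => by
    rw [map_mul, map_smul, hp]
    by_cases h : t = y <;> simp [h]
  have hpp : p * p = p := by rw [hpa, hpy, one_smul]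
  have hstar : star p = p := character_ext fun t => by
    rw [character_map_star, hp]
    by_cases h : t = y <;> simp [h]
  -- The closed subspace `K = pE` is the fibre of `E` at the isolated point.
  let K : Submodule ℂ E := (opSMulL p - ContinuousLinearMap.id ℂ E : E →L[ℂ] E).toLinearMap.ker
  have hK : ∀ x : E, x ∈ K ↔ p • x = x := fun x => by
    rw [LinearMap.mem_ker]
    exact sub_eq_zero
  have : CompleteSpace K :=
    (ContinuousLinearMap.isClosed_ker (opSMulL p - ContinuousLinearMap.id ℂ E)).completeSpace_coe
  have hinner : ∀ (k : K) (v : E), inner A (k : E) v = y (inner A (k : E) v) • p := by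
    intro k v
    rw [← hpa]
    conv_lhs => rw [← (hK k).mp k.2]
    rw [CStarModule.inner_op_smul_left, hstar, mul_comm]
  have hnorm : ∀ k : K, ‖(k : E)‖ ^ 2 = (y (inner A (k : E) (k : E))).re := by
    intro k
    refine le_antisymm ?_ (character_inner_self_le y (k : E))
    have h0 := (Complex.nonneg_iff.mp (character_inner_self_nonneg y (k : E))).1
    rw [CStarModule.norm_sq_eq A]
    refine norm_le_of_character_le h0 fun t => ?_
    have e : t (inner A (k : E) (k : E)) = y (inner A (k : E) (k : E)) • t p := by
      conv_lhs => rw [hinner, map_smul]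
    rw [e, hp, ← norm_character_inner_self]
    by_cases h : t = y <;> simp [h]
  let : InnerProductSpace ℂ K :=
    { inner := fun k l => y (inner A (k : E) (l : E))
      norm_sq_eq_re_inner := hnorm
      conj_inner_symm := fun k l => by
        rw [← CStarModule.star_inner (l : E) (k : E), character_map_star]
        rfl
      add_left := fun k l m => by
        rw [Submodule.coe_add, CStarModule.inner_add_left, map_add]
      smul_left := fun k l r => by
        rw [Submodule.coe_smul, CStarModule.inner_smul_left_complex, map_smul]
        rfl }
  have hdef : ∀ k l : K, inner ℂ k l = y (inner A (k : E) (l : E)) := fun _ _ => rfl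
  -- The Riesz representation of the functional `k ↦ conj (F ⟪k, ·⟫) (y)`.
  let Λ : K →L[ℂ] ℂ := LinearMap.mkContinuous
    { toFun := fun k => star (y (F.1 (innerDual (k : E))))
      map_add' := fun k l => by
        rw [Submodule.coe_add, innerDual_add, map_add, map_add, star_add]
      map_smul' := fun z k => by
        rw [Submodule.coe_smul, innerDual_smul, map_smul, map_smul, star_smul, star_star]
        rfl }
    ‖F‖ fun k => by
      change ‖star (y (F.1 (innerDual (k : E))))‖ ≤ _
      rw [norm_star]
      exact (norm_character_apply_le _ _).trans
        ((F.1.le_opNorm _).trans (mul_le_mul_of_nonneg_left (norm_innerDual_le _) (norm_nonneg _)))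
  let h : K := (InnerProductSpace.toDual ℂ K).symm Λ
  have hΛ : ∀ k : K, y (F.1 (innerDual (k : E))) = y (inner A (k : E) (h : E)) := by
    intro k
    have e : inner ℂ h k = star (y (F.1 (innerDual (k : E)))) :=
      InnerProductSpace.toDual_symm_apply
    rw [← hdef, ← inner_conj_symm, e]
    exact (star_star _).symm
  refine ⟨h, fun f => ?_⟩
  -- The restriction of `f` to the fibre is `⟪k, ·⟫` for some `k`, so that `p • f = p • ⟪k, ·⟫`.
  let φ : K →L[ℂ] ℂ := LinearMap.mkContinuous
    { toFun := fun l => y (f.1 (l : E))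
      map_add' := fun l m => by rw [Submodule.coe_add, map_add, map_add]
      map_smul' := fun z l => by rw [Submodule.coe_smul, map_smul, map_smul, RingHom.id_apply] }
    ‖f‖ fun l => (norm_character_apply_le _ _).trans (f.1.le_opNorm _)
  let k : K := (InnerProductSpace.toDual ℂ K).symm φ
  have hk : ∀ l : K, y (inner A (k : E) (l : E)) = y (f.1 (l : E)) := fun l =>
    InnerProductSpace.toDual_symm_apply (x := l) (y := φ)
  have e : p • f = p • (innerDual (k : E) : cstarDual A E) := by
    refine cstarDual_ext fun x => ?_
    have hpx : p • x ∈ K := by rw [hK, smul_smul, hpp]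
    have e1 := hk ⟨p • x, hpx⟩
    have e2 : f.1 (p • x) = p * f.1 x := f.2 p x
    simp only [CStarModule.inner_op_smul_right, e2, map_mul, hpy, one_mul] at e1
    rw [cstarDual_smul_apply, cstarDual_smul_apply, innerDual_apply, hpa, hpa, e1]
  have e1 : ∀ f : cstarDual A E, y (F.1 (p • f)) = y (F.1 f) := fun f => by
    have : F.1 (p • f) = p * F.1 f := F.2 p f
    rw [this, map_mul, hpy, one_mul]
  rw [← e1 f, e, e1, hΛ, hk]

end IsolatedPoint

/-! ### The gliding hump argument -/

section GlidingHump

variable {A E : Type*} [CommCStarAlgebra A] [NormedAddCommGroup E] [NormedSpace ℂ E] [Module A E]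

/-- If the `a k` have disjoint supports and norm at most one, then `∑ k, a k • g k` is a bounded
functional for every pointwise null sequence `g` in the dual module. -/
theorem exists_hasSum_smul_cstarDual [CompleteSpace E] {a : ℕ → A} {g : ℕ → cstarDual A E}
    (ha : Pairwise fun j k => a j * a k = 0) (ha1 : ∀ k, ‖a k‖ ≤ 1)
    (hg : ∀ x, Tendsto (fun k => (g k).1 x) atTop (𝓝 0)) :
    ∃ f : cstarDual A E, ∀ x, HasSum (fun k => a k * (g k).1 x) (f.1 x) := by
  have hs : ∀ x, Summable fun k => a k * (g k).1 x := by
    intro x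
    refine summable_iff_vanishing_norm.mpr fun ε hε => ?_
    obtain ⟨N, hN⟩ := Metric.tendsto_atTop.mp (hg x) (ε / 2) (half_pos hε)
    refine ⟨Finset.range N, fun t ht => ?_⟩
    have h1 := CommCStarAlgebra.nnnorm_sum_eq_sup (f := fun k => a k * (g k).1 x) t
      fun j k hjk => by
        change a j * (g j).1 x * (a k * (g k).1 x) = 0
        rw [mul_mul_mul_comm, ha hjk, zero_mul]
    have h2 : ‖∑ k ∈ t, a k * (g k).1 x‖₊ ≤ ⟨ε / 2, (half_pos hε).le⟩ := by
      rw [h1]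
      refine Finset.sup_le fun k hk => ?_
      have hk' : N ≤ k := by
        by_contra! hlt
        exact Finset.disjoint_left.mp ht hk (Finset.mem_range.mpr hlt)
      have h3 := (hN k hk').le
      rw [dist_zero_right] at h3
      change ‖a k * (g k).1 x‖ ≤ ε / 2
      calc _ ≤ ‖a k‖ * ‖(g k).1 x‖ := norm_mul_le _ _
        _ ≤ 1 * ‖(g k).1 x‖ := mul_le_mul_of_nonneg_right (ha1 k) (norm_nonneg _)
        _ ≤ ε / 2 := by rwa [one_mul]
    have h4 : ‖∑ k ∈ t, a k * (g k).1 x‖ ≤ ε / 2 := h2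
    linarith
  let G : ℕ → E →L[ℂ] A := fun n => (∑ k ∈ Finset.range n, a k • g k : cstarDual A E).1
  have hG : ∀ n x, G n x = ∑ k ∈ Finset.range n, a k * (g k).1 x := fun n x => by
    simp only [G, Submodule.coe_sum, sum_apply]
    rfl
  have hlim : Tendsto (fun n x => G n x) atTop (𝓝 fun x => ∑' k, a k * (g k).1 x) := by
    refine tendsto_pi_nhds.mpr fun x => ?_
    simp only [hG]
    exact (hs x).hasSum.tendsto_sum_nat
  refine ⟨⟨continuousLinearMapOfTendsto G hlim, fun b x => ?_⟩, fun x => (hs x).hasSum⟩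
  change ∑' k, a k * (g k).1 (b • x) = b * ∑' k, a k * (g k).1 x
  rw [← (hs x).tsum_mul_left]
  refine tsum_congr fun k => ?_
  have : (g k).1 (b • x) = b * (g k).1 x := (g k).2 b x
  rw [this, mul_left_comm]

/-- Bumps supported in disjoint annuli around `y₀`: the factor `4` separates the distances
`r` of the `w k` from `y₀` so well that the intervals `(r / 2, 3 r / 2)` are disjoint. -/
theorem exists_disjoint_bumps {Y : Type*} [MetricSpace Y] {y₀ : Y} {w : ℕ → Y}
    (hw : ∀ k, w k ≠ y₀) (hd : ∀ j k, j < k → 4 * dist (w k) y₀ < dist (w j) y₀) :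
    ∃ h : ℕ → C(Y, ℝ), (∀ k, h k (w k) = 1) ∧ (∀ k y, 0 ≤ h k y) ∧ (∀ k y, h k y ≤ 1) ∧
      ∀ j k, j ≠ k → ∀ y, h j y * h k y = 0 := by
  have hpos : ∀ k, 0 < dist (w k) y₀ := fun k => dist_pos.mpr (hw k)
  let h : ℕ → C(Y, ℝ) := fun k =>
    ⟨fun y => max 0 (1 - 2 * |dist y y₀ - dist (w k) y₀| / dist (w k) y₀), by fun_prop⟩
  have hh : ∀ k y, h k y = max 0 (1 - 2 * |dist y y₀ - dist (w k) y₀| / dist (w k) y₀) :=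
    fun _ _ => rfl
  have hsupp : ∀ k y, h k y ≠ 0 →
      dist (w k) y₀ < 2 * dist y y₀ ∧ 2 * dist y y₀ < 3 * dist (w k) y₀ := by
    intro k y hne
    have h1 : 0 < 1 - 2 * |dist y y₀ - dist (w k) y₀| / dist (w k) y₀ := by
      by_contra! hle
      exact hne (max_eq_left hle)
    rw [sub_pos, div_lt_one (hpos k)] at h1
    have := abs_lt.mp (show |dist y y₀ - dist (w k) y₀| < dist (w k) y₀ / 2 by linarith)
    constructor <;> linarith
  have hlt : ∀ j k, j < k → ∀ y, h j y * h k y = 0 := by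
    intro j k hjk y
    by_contra hne
    have h1 := hsupp j y (left_ne_zero_of_mul hne)
    have h2 := hsupp k y (right_ne_zero_of_mul hne)
    have h3 := hd j k hjk
    linarith [h1.1, h2.2, hpos k]
  refine ⟨h, fun k => by simp [hh], fun k y => le_max_left _ _, fun k y => ?_,
    fun j k hjk y => ?_⟩
  · have := hpos k
    rw [hh]
    exact max_le zero_le_one (sub_le_self _ (by positivity))
  · rcases hjk.lt_or_gt with hlt' | hlt'
    · exact hlt j k hlt' y
    · rw [mul_comm]
      exact hlt k j hlt' y

variable [CompleteSpace E] [TopologicalSpace.SeparableSpace A]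

/-- The gliding hump: if `F (g n)` stays away from zero along points of the spectrum approaching
`y₀` through other points, then `∑ k, a k • g (n k)`, with every second bump `a k` of a sequence
of disjoint bumps, is a functional on which `F` takes a value discontinuous at `y₀`. -/
theorem eventually_norm_character_bidual_le (F : cstarDual A (cstarDual A E))
    {g : ℕ → cstarDual A E} (hg : ∀ x, Tendsto (fun n => (g n).1 x) atTop (𝓝 0))
    (y₀ : characterSpace ℂ A) {ε : ℝ} (hε : 0 < ε) :
    ∃ N : ℕ, ∃ U ∈ 𝓝 y₀, ∀ n ≥ N, ∀ w ∈ U, w ≠ y₀ → ‖w (F.1 (g n))‖ ≤ ε := by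
  have := metrizableSpace_characterSpace (A := A)
  let := TopologicalSpace.metrizableSpaceMetric (characterSpace ℂ A)
  by_contra! H
  -- A subsequence of indices together with points approaching `y₀` geometrically fast.
  obtain ⟨q, hq, hq'⟩ := exists_seq_of_forall_finset_exists
    (fun q : ℕ × characterSpace ℂ A => q.2 ≠ y₀ ∧ ε < ‖q.2 (F.1 (g q.1))‖)
    (fun q r => q.1 < r.1 ∧ 4 * dist r.2 y₀ < dist q.2 y₀) (fun s hs => by
      obtain ⟨n, hn, w, hw, hne, hlt⟩ := H (s.sup fun q => q.1 + 1)
        (⋂ q ∈ s, {w | 4 * dist w y₀ < dist q.2 y₀}) (by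
          refine (Filter.biInter_finset_mem s).mpr fun q hqs => ?_
          refine IsOpen.mem_nhds (isOpen_lt (by fun_prop) continuous_const) ?_
          simpa using (hs q hqs).1)
      refine ⟨(n, w), ⟨hne, hlt⟩, fun q hqs => ⟨?_, ?_⟩⟩
      · exact Nat.lt_of_succ_le ((Finset.le_sup (f := fun q => q.1 + 1) hqs).trans hn)
      · exact Set.mem_iInter₂.mp hw q hqs)
  have hmono : StrictMono fun k => (q k).1 := strictMono_nat_of_lt_succ fun k =>
    (hq' k (k + 1) k.lt_succ_self).1
  obtain ⟨h, hw, h0, h1, hdisj⟩ := exists_disjoint_bumps (w := fun k => (q k).2)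
    (fun k => (hq k).1) (fun j k hjk => (hq' j k hjk).2)
  have hlim : Tendsto (fun k => (q k).2) atTop (𝓝 y₀) := by
    have hle : ∀ k, dist (q k).2 y₀ ≤ (1 / 4 : ℝ) ^ k * dist (q 0).2 y₀ := by
      intro k
      induction k with
      | zero => simp
      | succ k ih =>
        have := (hq' k (k + 1) k.lt_succ_self).2
        rw [pow_succ]
        linarith
    refine tendsto_iff_dist_tendsto_zero.mpr
      (squeeze_zero (fun _ => dist_nonneg) hle ?_)
    simpa using (tendsto_pow_atTop_nhds_zero_of_lt_one (r := (1 / 4 : ℝ)) (by norm_num)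
      (by norm_num)).mul_const (dist (q 0).2 y₀)
  choose b hb using fun k => exists_character_apply_eq (A := A)
    ⟨fun y => (h k y : ℂ), by fun_prop⟩
  simp only [ContinuousMap.coe_mk] at hb
  have hbdisj : ∀ j k, j ≠ k → b j * b k = 0 := fun j k hjk => character_ext fun y => by
    rw [map_mul, map_zero, hb, hb, ← Complex.ofReal_mul, hdisj j k hjk, Complex.ofReal_zero]
  let c : ℕ → ℂ := fun k => if Even k then 1 else 0
  obtain ⟨f, hf⟩ := exists_hasSum_smul_cstarDual (a := fun k => c k • b k)
    (g := fun k => g (q k).1) (fun j k hjk => by simp [hbdisj j k hjk]) (fun k => by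
      refine norm_le_of_character_le zero_le_one fun y => ?_
      rw [map_smul, norm_smul, hb, Complex.norm_real, Real.norm_of_nonneg (h0 k y)]
      by_cases hk : Even k <;> simp [c, hk, h1 k y])
    fun x => (hg x).comp hmono.tendsto_atTop
  -- Cutting down by the bump `b k` isolates the `k`-th term of the series.
  have hF : ∀ k, (q k).2 (F.1 f) = c k * (q k).2 (F.1 (g (q k).1)) := by
    intro k
    have e : b k • f = (c k • (b k * b k)) • g (q k).1 := by
      refine cstarDual_ext fun x => ?_
      refine HasSum.unique ((hf x).mul_left (b k)) ?_
      convert hasSum_single k fun j hjk => ?_ using 1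
      · rw [cstarDual_smul_apply, smul_mul_assoc, smul_mul_assoc, mul_smul_comm, mul_assoc]
      · rw [smul_mul_assoc, mul_smul_comm, ← mul_assoc, hbdisj k j hjk.symm, zero_mul, smul_zero]
    have e1 : F.1 (b k • f) = b k * F.1 f := F.2 _ _
    have e2 : F.1 ((c k • (b k * b k)) • g (q k).1) = c k • (b k * b k) * F.1 (g (q k).1) :=
      F.2 _ _
    rw [e, e2] at e1
    have e3 := congrArg (q k).2 e1
    rw [map_mul, map_smul, map_mul, map_mul, hb, hw] at e3
    simpa using e3.symm
  have hcont : Tendsto (fun k => ‖(q k).2 (F.1 f)‖) atTop (𝓝 ‖y₀ (F.1 f)‖) :=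
    (((continuous_character_apply (F.1 f)).tendsto y₀).comp hlim).norm
  have heven : Tendsto (fun k : ℕ => 2 * k) atTop atTop :=
    tendsto_atTop_mono (fun k => by dsimp only [id]; omega) tendsto_id
  have hodd : Tendsto (fun k : ℕ => 2 * k + 1) atTop atTop :=
    tendsto_atTop_mono (fun k => by dsimp only [id]; omega) tendsto_id
  have l1 : ε ≤ ‖y₀ (F.1 f)‖ := ge_of_tendsto' (hcont.comp heven) fun k => by
    have := (hq (2 * k)).2
    simpa [hF, c] using this.le
  have l2 : ‖y₀ (F.1 f)‖ ≤ 0 := le_of_tendsto' (hcont.comp hodd) fun k => by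
    simp [hF, c]
  linarith

end GlidingHump

/-! ### Reflexivity of separable Hilbert modules -/

section Reflexivity

variable {A E : Type*} [CommCStarAlgebra A] [PartialOrder A] [StarOrderedRing A]
  [NormedAddCommGroup E] [NormedSpace ℂ E] [Module A E] [CStarModule A E] [CompleteSpace E]

/-- Elements of the bidual map pointwise null sequences of functionals to norm null sequences. -/
theorem tendsto_bidual_zero [TopologicalSpace.SeparableSpace A]
    (F : cstarDual A (cstarDual A E)) {g : ℕ → cstarDual A E}
    (hg : ∀ x, Tendsto (fun n => (g n).1 x) atTop (𝓝 0)) :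
    Tendsto (fun n => F.1 (g n)) atTop (𝓝 0) := by
  have hloc : ∀ ε > (0 : ℝ), ∀ y : characterSpace ℂ A, ∃ N : ℕ, ∃ U ∈ 𝓝 y,
      ∀ n ≥ N, ∀ w ∈ U, ‖w (F.1 (g n))‖ ≤ ε := by
    intro ε hε y
    obtain ⟨N, U, hU, h⟩ := eventually_norm_character_bidual_le F hg y hε
    suffices ∃ M : ℕ, ∀ n ≥ M, ‖y (F.1 (g n))‖ ≤ ε by
      obtain ⟨M, hM⟩ := this
      refine ⟨max N M, U, hU, fun n hn w hw => ?_⟩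
      by_cases hwy : w = y
      · rw [hwy]
        exact hM n ((le_max_right N M).trans hn)
      · exact h n ((le_max_left N M).trans hn) w hw hwy
    by_cases hy : IsOpen {y}
    · obtain ⟨x, hx⟩ := exists_eval_of_isOpen_singleton hy F
      obtain ⟨M, hM⟩ := Metric.tendsto_atTop.mp (hg x) ε hε
      refine ⟨M, fun n hn => ?_⟩
      rw [hx]
      have h1 := (hM n hn).le
      rw [dist_zero_right] at h1
      exact (norm_character_apply_le _ _).trans h1
    · -- At a non-isolated point the estimate follows from nearby points by continuity.
      rw [isOpen_singleton_iff_punctured_nhds] at hy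
      have : (𝓝[≠] y).NeBot := ⟨hy⟩
      refine ⟨N, fun n hn => ?_⟩
      refine le_of_tendsto (((continuous_character_apply (F.1 (g n))).tendsto y).norm.mono_left
        (nhdsWithin_le_nhds (s := {y}ᶜ))) ?_
      filter_upwards [nhdsWithin_le_nhds hU, self_mem_nhdsWithin] with w hw hwy
      exact h n hn w hw hwy
  refine Metric.tendsto_atTop.mpr fun ε hε => ?_
  choose N U hU h using hloc (ε / 2) (half_pos hε)
  obtain ⟨t, -, ht⟩ := isCompact_univ.elim_nhds_subcover U fun y _ => hU y
  refine ⟨t.sup N, fun n hn => ?_⟩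
  rw [dist_zero_right]
  refine (norm_le_of_character_le (half_pos hε).le fun w => ?_).trans_lt (half_lt_self hε)
  obtain ⟨y, hy, hwy⟩ := Set.mem_iUnion₂.mp (ht (Set.mem_univ w))
  exact h y n ((Finset.le_sup hy).trans hn) w hwy

omit [CompleteSpace E] in
variable (A E) in
theorem isometry_coe_toCStarBidual : Isometry fun x : E => (toCStarBidual A E x).1 := by
  have hnorm : ∀ x : E, ‖(toCStarBidual A E x).1‖ = ‖x‖ := fun x => by
    refine le_antisymm ?_ ?_
    · refine ContinuousLinearMap.opNorm_le_bound _ (norm_nonneg x) fun f => ?_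
      rw [mul_comm]
      exact f.1.le_opNorm x
    · have h : ‖inner A x x‖ ≤ ‖(toCStarBidual A E x).1‖ * ‖(innerDual x : cstarDual A E)‖ :=
        (toCStarBidual A E x).1.le_opNorm (innerDual x)
      rw [← CStarModule.norm_sq_eq A] at h
      by_contra! hlt
      have h1 := mul_le_mul_of_nonneg_left (norm_innerDual_le (A := A) x)
        (norm_nonneg (toCStarBidual A E x).1)
      have h2 : 0 < ‖x‖ := (norm_nonneg _).trans_lt hlt
      nlinarith
  refine Isometry.of_dist_eq fun x v => ?_
  have e : (toCStarBidual A E x).1 - (toCStarBidual A E v).1 = (toCStarBidual A E (x - v)).1 :=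
    ContinuousLinearMap.ext fun f => (map_sub f.1 x v).symm
  rw [dist_eq_norm, dist_eq_norm, e, hnorm]

variable (A E) in
/-- Separable Hilbert modules over separable commutative unital C*-algebras are C*-reflexive. -/
theorem cstarReflexive_of_separable [TopologicalSpace.SeparableSpace A]
    [TopologicalSpace.SeparableSpace E] : CStarReflexive A E := by
  have hiso := isometry_coe_toCStarBidual A E
  refine ⟨fun x v h => hiso.injective (congrArg Subtype.val h), fun F => ?_⟩
  suffices F.1 ∈ Set.range fun x : E => (toCStarBidual A E x).1 by
    obtain ⟨x, hx⟩ := this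
    exact ⟨x, Subtype.ext hx⟩
  rw [← hiso.isClosedEmbedding.isClosed_range.closure_eq, Metric.mem_closure_range_iff]
  intro ε hε
  obtain ⟨R, hR, hc, hlim⟩ := exists_residual_tendsto_zero A E
  choose z hz using fun n => (hR n).bidual F
  by_contra! H
  -- If `F` were far from all the evaluations at `z n`, then `F (f n ∘ R n)` would stay away from
  -- zero for some `f n` in the unit ball.
  have hex : ∀ n, ∃ f : cstarDual A E, ‖f‖ < 1 ∧ ε / 2 < ‖F.1 f - f.1 (z n)‖ := fun n => by
    have h1 : ε / 2 < ‖F.1 - (toCStarBidual A E (z n)).1‖ := by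
      have := H (z n)
      rw [dist_eq_norm] at this
      exact (half_lt_self hε).trans_le this
    exact ContinuousLinearMap.exists_lt_apply_of_lt_opNorm _ h1
  choose f hf1 hf using hex
  have hnull := tendsto_bidual_zero F (g := fun n => cstarDualComp (f n) (R n) (hR n).map_smul)
    fun x => squeeze_zero_norm (fun n => ((f n).1.le_opNorm _).trans
      (mul_le_of_le_one_left (norm_nonneg _) (hf1 n).le)) (by simpa using (hlim x).norm)
  obtain ⟨N, hN⟩ := Metric.tendsto_atTop.mp hnull (ε / 2) (half_pos hε)
  have h1 := hN N le_rfl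
  have h2 := hf N
  rw [hz N (f N) _ (cstarDualComp_apply (f N) (R N) (hR N).map_smul), add_sub_cancel_right] at h2
  rw [dist_zero_right] at h1
  exact lt_asymm h1 h2

end Reflexivity

/-! ### The module of a Lyapunov stable action -/

section LGamma

variable {Γ X : Type*} [Group Γ] [MetricSpace X] [CompactSpace X] [MulAction Γ X]
  [LyapunovStable Γ X]

/-- The norm of the Hilbert module is dominated by the uniform norm. -/
theorem PreModule.norm_le_norm_toFn (φ : PreModule Γ X) : ‖φ‖ ≤ ‖φ.toFn‖ := by
  refine (sq_le_sq₀ (norm_nonneg _) (norm_nonneg _)).mp ?_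
  rw [CStarModule.norm_sq_eq (invariantFunctions Γ X)]
  change ‖(inner (invariantFunctions Γ X) φ φ : C(X, ℂ))‖ ≤ _
  refine (ContinuousMap.norm_le _ (sq_nonneg _)).mpr fun x => ?_
  have h := IsMeanValue.dist_le (PreModule.isMeanValue_inner φ φ x) (IsMeanValue.const 0)
    (η := ‖φ.toFn‖ ^ 2) fun g => by
      rw [sub_zero, norm_mul, norm_star, ← pow_two]
      gcongr
      exact φ.toFn.norm_coe_le_norm _
  rwa [sub_zero] at h

instance PreModule.separableSpace : TopologicalSpace.SeparableSpace (PreModule Γ X) := by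
  let L : C(X, ℂ) →+ PreModule Γ X := AddMonoidHom.id C(X, ℂ)
  have hL : Continuous L := AddMonoidHomClass.continuous_of_bound L 1 fun φ => by
    rw [one_mul]
    exact PreModule.norm_le_norm_toFn (Γ := Γ) φ
  exact (show Function.Surjective L from Function.surjective_id).denseRange.separableSpace hL

end LGamma

theorem mainTheorem4 {Γ X : Type*} [Group Γ] [MetricSpace X] [CompactSpace X] [MulAction Γ X]
    [LyapunovStable Γ X] :
    CStarReflexive (invariantFunctions Γ X) (LGamma Γ X) :=
  cstarReflexive_of_separable (invariantFunctions Γ X) (LGamma Γ X)
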